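/- Let $d\ge 1$. A wireless multiple unicast configuration in dimension $d$ is $C=\{V,r,M\}$, where $V\subset\mathbb{R}^d$ is a finite set of nodes, $r>0$ is a transmission range and $M$ is a set of unicast sessions, i.e. pairs (source, receiver) of nodes of $V$. The source of each session holds a sequence of independent symbols from $\mathbb{F}_2$, to be delivered to the receiver of the session. Transmissions are made sequentially; in each one a node $v$ broadcasts one symbol of $\mathbb{F}_2$ to all nodes $u\in V$ with $\|u-v\|\le r$ (Euclidean norm). In a routing solution a node transmits only symbols that it has received or that are source symbols of its own sessions; in a network coding solution it may transmit any $\mathbb{F}_2$-linear combination of such symbols, and receivers decode by taking such linear combinations. If a solution delivers $n\ge1$ symbols for every session with $T$ transmissions, it uses $T/n$ transmissions per symbol delivered for each session. The energy benefit of network coding in dimension $d$ is $$\sup_{C}\ \frac{\text{minimum (infimum) number of transmissions per symbol over all routing solutions on } C}{\text{minimum (infimum) number of transmissions per symbol over all network coding solutions on } C},$$ where $C$ ranges over the configurations in dimension $d$ that have a solution and in which at least one transmission is required; routing and network coding use the same nodes and the same range $r$. Theorem. For every $d\ge1$ the energy benefit of network coding in dimension $d$ is at least $2d/\lfloor\sqrt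 d\rfloor$. In particular it is at least $4$ for $d=2$ and at least $6$ for $d=3$. -/

import Mathlib

open scoped ENNReal

namespace WirelessUnicast

/-- Points of `ℝ^d` with the Euclidean norm. -/
abbrev Point (d : ℕ) := EuclideanSpace ℝ (Fin d)

/-- A unicast session, given by its (source, receiver). -/
abbrev Session (d : ℕ) := Point d × Point d

/-- A wireless multiple unicast configuration `{V, r, M}` in dimension `d`: a finite set of nodes,
a transmission range, and a set of unicast sessions between nodes. -/
structure Config (d : ℕ) where
  nodes : Finset (Point d)
  range : ℝ
  range_pos : 0 < range
  sessions : Finset (Session d)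
  source_mem : ∀ m ∈ sessions, m.1 ∈ nodes
  receiver_mem : ∀ m ∈ sessions, m.2 ∈ nodes

/-- A transmitted symbol: a formal `𝔽₂`-linear combination of source symbols. The pair `(m, j)`
stands for the `j`-th source symbol of session `m`. -/
abbrev Symb (d : ℕ) := (Session d × ℕ) →₀ ZMod 2

/-- The `j`-th source symbol of session `m`. -/
noncomputable def sourceSymbol {d : ℕ} (m : Session d) (j : ℕ) : Symb d :=
  Finsupp.single (m, j) 1

/-- One transmission: the transmitting node and the symbol it broadcasts. -/
abbrev Transmission (d : ℕ) := Point d × Symb d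

/-- A processing rule says which symbols a node can produce from a set of available symbols. -/
abbrev Rule (d : ℕ) := Set (Symb d) → Set (Symb d)

/-- Routing: a node can only reproduce an available symbol. -/
def routing (d : ℕ) : Rule d := fun S => S

/-- Network coding: a node can produce every `𝔽₂`-linear combination of available symbols
(decoded or not). -/
def networkCoding (d : ℕ) : Rule d := fun S => (Submodule.span (ZMod 2) S : Set (Symb d))

namespace Config

variable {d : ℕ}

/-- The symbols available at node `u` when each session has `n` source symbols and the transmissions
in `L` have been made: the source symbols of the sessions with source `u`, and every symbol that
was broadcast by a node within range of `u`. -/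
def available (C : Config d) (n : ℕ) (L : List (Transmission d)) (u : Point d) : Set (Symb d) :=
  {σ | ∃ m ∈ C.sessions, m.1 = u ∧ ∃ j < n, σ = sourceSymbol m j} ∪
  {σ | ∃ v, (v, σ) ∈ L ∧ ‖u - v‖ ≤ C.range}

/-- Sequential schedules, latest transmission first: every transmission is made by a node, which
produces the symbol from those available to it at that moment. -/
inductive IsSchedule (C : Config d) (rule : Rule d) (n : ℕ) : List (Transmission d) → Prop
  | nil : IsSchedule C rule n []
  | cons {L : List (Transmission d)} {v : Point d} {σ : Symb d} :
      IsSchedule C rule n L → v ∈ C.nodes → σ ∈ rule (C.available n L v) →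
      IsSchedule C rule n ((v, σ) :: L)

/-- `L` is a solution delivering `n` symbols for each session: it is a schedule after which every
receiver can produce each of the `n` source symbols of its session. -/
def IsSolution (C : Config d) (rule : Rule d) (n : ℕ) (L : List (Transmission d)) : Prop :=
  C.IsSchedule rule n L ∧
    ∀ m ∈ C.sessions, ∀ j < n, sourceSymbol m j ∈ rule (C.available n L m.2)

/-- The minimum (infimum) number of transmissions required under `rule`, per symbol delivered
for each session. It is `⊤` if there is no solution. -/
noncomputable def minTransmissions (C : Config d) (rule : Rule d) : ℝ≥0∞ :=
  ⨅ (n : ℕ) (_ : 1 ≤ n) (L : List (Transmission d)) (_ : C.IsSolution rule n L),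
    (L.length : ℝ≥0∞) / (n : ℝ≥0∞)

end Config

/-- The energy benefit of network coding in dimension `d`: the supremum over all configurations of
the ratio of the transmissions required by routing to those required by network coding.
A configuration without solutions (`⊤ / ⊤ = 0`), or in which nothing has to be
transmitted (`0 / 0 = 0`), does not contribute. -/
noncomputable def energyBenefit (d : ℕ) : ℝ≥0∞ :=
  ⨆ C : Config d, C.minTransmissions (routing d) / C.minTransmissions (networkCoding d)

end WirelessUnicast

/-!
The configuration is the box `{0, …, K + 1}ᵈ` with range `√d`, and with sessions in both directions
between opposite faces along each of the `d Kᵈ⁻¹` axis-parallel lines that pass through the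
interior.

Under routing, a hop between lattice points within distance `√d` changes each coordinate by at most
`⌊√d⌋`, so each symbol costs at least `(K + 1) / ⌊√d⌋` transmissions
(`Config.le_floor_mul_length`), and a symbol for every session costs at least
`2 d Kᵈ⁻¹ (K + 1) / ⌊√d⌋`.

With coding, let the symbols of each session travel along its line at unit speed, one wave for each
axis direction, and let each interior node broadcast at each time the sum of the `2 d` waves at its
position (`field`). The discrete wave operator
`φ(x, t + 1) + φ(x, t - 1) - φ(x + eᵢ, t) - φ(x - eᵢ, t)` annihilates both waves along the axis `i`.
These operators commute, so their product over all `i` annihilates the field. Since the product is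
monic in time and reaches only `x + {-1, 0, 1}ᵈ`, which is within range of `x`, a node can compute
the field at its position from what it heard before (`field_mem_pastSpan`). The product over all
axes but one separates the two waves along that axis from the others, by which the end node of a
line decodes the symbols that arrive there (`arriving_mem_knowledge`). End nodes broadcast the
departing and the arriving symbol separately, which costs only `O(Kᵈ⁻¹)`. Each time step takes
`Kᵈ + 4 d Kᵈ⁻¹` transmissions, and `n` symbols take `n + K + 1` steps
(`minTransmissions_networkCoding_grid_le`). For `n = (K + 1)²` the ratio tends to `2 d / ⌊√d⌋` as
`K` grows.
-/

namespace WirelessUnicast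

/-! ### Products of discrete wave operators -/

section WaveOperators

variable {ι : Type*} {A : Type*} [AddCommGroup A]

section

variable (R : Type*) [Ring R] [Module R A]

/-- The span of the values of `φ` at times before `t`, at the lattice points that differ from `x`
by at most `c j` in each coordinate `j`. -/
def pastSpan (φ : (ι → ℤ) → ℤ → A) (c : ι → ℤ) (x : ι → ℤ) (t : ℤ) : Submodule R A :=
  Submodule.span R {σ | ∃ y s, (∀ j, |y j - x j| ≤ c j) ∧ s < t ∧ φ y s = σ}

variable {R}

lemma mem_pastSpan {φ : (ι → ℤ) → ℤ → A} {c : ι → ℤ} {x y : ι → ℤ} {s t : ℤ}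
    (hy : ∀ j, |y j - x j| ≤ c j) (hs : s < t) : φ y s ∈ pastSpan R φ c x t :=
  Submodule.subset_span ⟨y, s, hy, hs, rfl⟩

lemma pastSpan_mono {φ : (ι → ℤ) → ℤ → A} {c c' : ι → ℤ} {x x' : ι → ℤ} {t t' : ℤ}
    (h : ∀ j, c j + |x j - x' j| ≤ c' j) (ht : t ≤ t') :
    pastSpan R φ c x t ≤ pastSpan R φ c' x' t' := by
  refine Submodule.span_le.2 ?_
  rintro _ ⟨y, s, hy, hs, rfl⟩
  refine mem_pastSpan (fun j => ?_) (hs.trans_le ht)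
  have := abs_sub_le (y j) (x j) (x' j)
  linarith [hy j, h j]

end

variable [DecidableEq ι]

/-- The discrete wave operator in direction `i`, acting on functions of a lattice point and an
integer time. It annihilates every wave that travels at unit speed along the `i`-th axis, in
either direction. -/
def waveOp (i : ι) : AddMonoid.End ((ι → ℤ) → ℤ → A) where
  toFun φ x t := φ x (t + 1) + φ x (t - 1) - φ (x + Pi.single i 1) t - φ (x - Pi.single i 1) t
  map_zero' := by funext x t; simp
  map_add' φ ψ := by funext x t; simp only [Pi.add_apply]; abel

lemma waveOp_apply (i : ι) (φ : (ι → ℤ) → ℤ → A) (x : ι → ℤ) (t : ℤ) :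
    waveOp i φ x t =
      φ x (t + 1) + φ x (t - 1) - φ (x + Pi.single i 1) t - φ (x - Pi.single i 1) t := rfl

lemma commute_waveOp (i j : ι) : Commute (waveOp (A := A) i) (waveOp j) := by
  refine AddMonoidHom.ext fun φ => funext₂ fun x t => ?_
  change waveOp i (waveOp j φ) x t = waveOp j (waveOp i φ) x t
  simp only [waveOp_apply]
  generalize (Pi.single i 1 : ι → ℤ) = a
  generalize (Pi.single j 1 : ι → ℤ) = b
  rw [add_right_comm x a b, add_sub_right_comm x a b, sub_add_eq_add_sub x a b, sub_right_comm x a b,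
    add_sub_right_comm x b a]
  abel

lemma waveProd_eq_zero {l : List ι} {i : ι} (hi : i ∈ l) {φ : (ι → ℤ) → ℤ → A}
    (h : waveOp i φ = 0) : (l.map waveOp).prod φ = 0 := by
  induction l with
  | nil => simp at hi
  | cons j l ih =>
    rw [List.map_cons, List.prod_cons]
    rcases List.mem_cons.1 hi with rfl | hi
    · have hc : Commute (waveOp (A := A) i) (l.map waveOp).prod :=
        Commute.list_prod_right _ _ fun y hy => by
          obtain ⟨k, -, rfl⟩ := List.mem_map.1 hy
          exact commute_waveOp i k
      rw [hc.eq]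
      change (l.map waveOp).prod (waveOp i φ) = 0
      rw [h, map_zero]
    · change waveOp j ((l.map waveOp).prod φ) = 0
      rw [ih hi, map_zero]

variable {R : Type*} [Ring R] [Module R A]

/-- A product of wave operators is monic in time: its latest term is the value at `x` itself, and
all other terms lie in the past of `x`, one step away in each direction of the product. -/
lemma waveProd_sub_mem_pastSpan (φ : (ι → ℤ) → ℤ → A) (l : List ι) (x : ι → ℤ) (t : ℤ) :
    (l.map waveOp).prod φ x t - φ x (t + l.length) ∈
      pastSpan R φ (fun j => (l.count j : ℤ)) x (t + l.length) := by
  induction l generalizing x t with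
  | nil => simp
  | cons i l ih =>
    set ψ := (l.map waveOp).prod φ with hψ
    have hcons : ((i :: l).map waveOp).prod φ = waveOp i ψ := by
      rw [List.map_cons, List.prod_cons]; rfl
    have hnear : ∀ y s, (∀ j, |y j - x j| ≤ if i = j then 1 else 0) → s ≤ t →
        ψ y s ∈ pastSpan R φ (fun j => ((i :: l).count j : ℤ)) x (t + (i :: l).length) := by
      intro y s hy hs
      have hc : ∀ j, (l.count j : ℤ) + |y j - x j| ≤ ((i :: l).count j : ℤ) := by
        intro j
        have := hy j
        rw [List.count_cons]
        by_cases hij : i = j <;> simp_all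
      have h1 := pastSpan_mono (R := R) (φ := φ) (t := s + l.length)
        (t' := t + (i :: l).length) hc (by simp; omega) (ih y s)
      have h2 : φ y (s + l.length) ∈
          pastSpan R φ (fun j => ((i :: l).count j : ℤ)) x (t + (i :: l).length) :=
        mem_pastSpan (fun j => by have := hc j; omega) (by simp; omega)
      simpa using add_mem h1 h2
    have h0 : ψ x (t + 1) - φ x (t + (i :: l).length) ∈
        pastSpan R φ (fun j => ((i :: l).count j : ℤ)) x (t + (i :: l).length) := by
      have e : t + ((i :: l).length : ℤ) = t + 1 + l.length := by simp; ring
      rw [e]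
      refine pastSpan_mono (fun j => ?_) le_rfl (ih x (t + 1))
      rw [List.count_cons]
      simp
      split_ifs <;> simp
    have hp : ∀ j, |(x + Pi.single i 1 : ι → ℤ) j - x j| ≤ if i = j then (1 : ℤ) else 0 := by
      intro j
      rcases eq_or_ne i j with rfl | h
      · simp
      · simp [h]
    have hm : ∀ j, |(x - Pi.single i 1 : ι → ℤ) j - x j| ≤ if i = j then (1 : ℤ) else 0 := by
      intro j
      rcases eq_or_ne i j with rfl | h
      · simp
      · simp [h]
    have h1 := hnear x (t - 1) (fun j => by simp; split_ifs <;> simp) (by omega)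
    rw [hcons, waveOp_apply]
    have := sub_mem (sub_mem (add_mem h0 h1) (hnear _ t hp le_rfl)) (hnear _ t hm le_rfl)
    convert this using 1
    abel

/-- If a product of wave operators annihilates `φ`, then each value of `φ` can be computed from
earlier values nearby. -/
lemma mem_pastSpan_of_waveProd_eq_zero {φ : (ι → ℤ) → ℤ → A} {l : List ι}
    (h : (l.map waveOp).prod φ = 0) (x : ι → ℤ) (t : ℤ) :
    φ x t ∈ pastSpan R φ (fun j => (l.count j : ℤ)) x t := by
  have := waveProd_sub_mem_pastSpan (R := R) φ l x (t - l.length)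
  simpa [h] using this

end WaveOperators

/-! ### Building schedules step by step -/

section Schedules

variable {d : ℕ}

/-- The concatenation of the first `τ` of the lists `B 0, B 1, …`, latest transmissions first. -/
def steps (B : ℕ → List (Transmission d)) : ℕ → List (Transmission d)
  | 0 => []
  | τ + 1 => B τ ++ steps B τ

lemma mem_steps {B : ℕ → List (Transmission d)} {τ s : ℕ} (hs : s < τ) {p : Transmission d}
    (hp : p ∈ B s) : p ∈ steps B τ := by
  induction τ with
  | zero => omega
  | succ τ ih =>
    rw [steps, List.mem_append]
    rcases Nat.lt_succ_iff_lt_or_eq.1 hs with h | rfl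
    · exact Or.inr (ih h)
    · exact Or.inl hp

lemma length_steps {B : ℕ → List (Transmission d)} {c : ℕ} (hB : ∀ τ, (B τ).length = c) (τ : ℕ) :
    (steps B τ).length = τ * c := by
  induction τ with
  | zero => simp [steps]
  | succ τ ih => rw [steps, List.length_append, ih, hB]; ring

lemma Config.available_mono (C : Config d) (n : ℕ) {L L' : List (Transmission d)}
    (h : ∀ p ∈ L, p ∈ L') (u : Point d) : C.available n L u ⊆ C.available n L' u :=
  Set.union_subset_union_right _ fun _ ⟨v, hv, hr⟩ => ⟨v, h _ hv, hr⟩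

/-- Transmissions that use only what was heard in earlier steps can be made in any order within
their step. -/
lemma Config.isSchedule_steps (C : Config d) {n : ℕ} {B : ℕ → List (Transmission d)}
    (h : ∀ τ, ∀ p ∈ B τ, p.1 ∈ C.nodes ∧
      p.2 ∈ Submodule.span (ZMod 2) (C.available n (steps B τ) p.1)) (τ : ℕ) :
    C.IsSchedule (networkCoding d) n (steps B τ) := by
  induction τ with
  | zero => exact .nil
  | succ τ ih =>
    have key : ∀ l : List (Transmission d), (∀ p ∈ l, p ∈ B τ) →
        C.IsSchedule (networkCoding d) n (l ++ steps B τ) := by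
      intro l hl
      induction l with
      | nil => exact ih
      | cons p l ihl =>
        obtain ⟨hp1, hp2⟩ := h τ p (hl p (by simp))
        refine .cons (ihl fun q hq => hl q (by simp [hq])) hp1 ?_
        exact Submodule.span_mono (C.available_mono n (fun q hq => by simp [hq]) _) hp2
    exact key _ fun _ hp => hp

lemma Config.minTransmissions_le (C : Config d) {rule : Rule d} {n : ℕ} (hn : 1 ≤ n)
    {L : List (Transmission d)} (h : C.IsSolution rule n L) :
    C.minTransmissions rule ≤ (L.length : ℝ≥0∞) / n :=
  iInf₂_le_of_le n hn (iInf₂_le L h)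

end Schedules

/-! ### Routing on the integer lattice -/

section Routing

variable {d : ℕ}

/-- An integer point, as a point of Euclidean space. -/
noncomputable def latticePoint (x : Fin d → ℤ) : Point d := WithLp.toLp 2 fun j => (x j : ℝ)

@[simp] lemma latticePoint_apply (x : Fin d → ℤ) (j : Fin d) : latticePoint x j = x j := rfl

lemma latticePoint_injective : Function.Injective (latticePoint (d := d)) := by
  intro x y h
  funext j
  have := congrArg (fun p : Point d => p j) h
  simpa using this

lemma norm_latticePoint_sub_le {x y : Fin d → ℤ} (h : ∀ j, |x j - y j| ≤ 1) :
    ‖latticePoint x - latticePoint y‖ ≤ √d := by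
  rw [EuclideanSpace.norm_eq]
  refine Real.sqrt_le_sqrt ?_
  calc ∑ j, ‖(latticePoint x - latticePoint y) j‖ ^ 2 ≤ ∑ _j : Fin d, (1 : ℝ) := by
        refine Finset.sum_le_sum fun j _ => ?_
        have : |(x j : ℝ) - y j| ≤ 1 := by exact_mod_cast h j
        simpa using this
    _ = d := by simp

lemma abs_sub_le_floor_of_norm_le {x y : Fin d → ℤ} {r : ℝ}
    (h : ‖latticePoint x - latticePoint y‖ ≤ r) (i : Fin d) :
    |(x i : ℝ) - y i| ≤ (⌊r⌋₊ : ℝ) := by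
  have h1 : |(x i : ℝ) - y i| ≤ r := by
    have := (PiLp.norm_apply_le (latticePoint x - latticePoint y) i).trans h
    simpa using this
  have h2 : ((x i - y i).natAbs : ℝ) = |(x i : ℝ) - y i| := by
    rw [Nat.cast_natAbs]; push_cast; rfl
  rw [← h2] at h1 ⊢
  exact_mod_cast Nat.le_floor h1

lemma sourceSymbol_injective {m m' : Session d} {j j' : ℕ}
    (h : sourceSymbol m j = sourceSymbol m' j') : m = m' ∧ j = j' := by
  simpa using Finsupp.single_left_injective (one_ne_zero (α := ZMod 2)) h

lemma sum_count_le_length {α : Type*} [DecidableEq α] (s : Finset α) (l : List α) :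
    ∑ a ∈ s, l.count a ≤ l.length := by
  induction l with
  | nil => simp
  | cons b l ih =>
    simp only [List.count_cons, Finset.sum_add_distrib, List.length_cons, beq_iff_eq,
      Finset.sum_ite_eq]
    split_ifs <;> omega

open Classical in
/-- Under routing, each transmission of a symbol carries it at most `⌊r⌋` further along any
coordinate axis when all nodes have integer coordinates. -/
lemma Config.abs_coord_sub_le (C : Config d) (hC : ∀ v ∈ C.nodes, ∃ x, v = latticePoint x)
    {n : ℕ} {L : List (Transmission d)} (h : C.IsSchedule (routing d) n L)
    (m : Session d) (j : ℕ) (i : Fin d) {u : Point d} (hu : u ∈ C.nodes)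
    (hσ : sourceSymbol m j ∈ C.available n L u) :
    |u i - m.1 i| ≤ (⌊C.range⌋₊ : ℝ) * (L.map Prod.snd).count (sourceSymbol m j) := by
  induction h generalizing u with
  | nil =>
    rcases hσ with ⟨m', -, hm', j', -, he⟩ | ⟨v, hv, -⟩
    · obtain ⟨rfl, -⟩ := sourceSymbol_injective he
      simp [hm']
    · simp at hv
  | @cons L v τ hL hv hτ ih =>
    have hmono : ((L.map Prod.snd).count (sourceSymbol m j) : ℝ) ≤
        (((v, τ) :: L).map Prod.snd).count (sourceSymbol m j) := by
      rw [List.map_cons]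
      exact_mod_cast List.count_le_count_cons
    have hold : sourceSymbol m j ∈ C.available n L u → _ := fun h =>
      (ih hu h).trans (mul_le_mul_of_nonneg_left hmono (Nat.cast_nonneg ⌊C.range⌋₊))
    rcases hσ with hs | ⟨w, hw, hr⟩
    · exact hold (Or.inl hs)
    · rcases List.mem_cons.1 hw with he | hw
      · obtain ⟨rfl, rfl⟩ := Prod.mk.inj he
        obtain ⟨x, rfl⟩ := hC _ hu
        obtain ⟨y, rfl⟩ := hC _ hv
        have h1 := abs_sub_le_floor_of_norm_le hr i
        have h2 := ih hv hτ
        rw [List.map_cons, List.count_cons_self]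
        have h3 := abs_sub_le (latticePoint x i) (latticePoint y i) (m.1 i)
        simp only [latticePoint_apply] at h1 h2 h3 ⊢
        push_cast
        linarith
      · exact hold (Or.inr ⟨w, hw, hr⟩)

/-- A routing solution makes at least `D / ⌊r⌋` transmissions of each source symbol if every
receiver is at distance at least `D` from its source along some coordinate axis. -/
lemma Config.le_floor_mul_length (C : Config d) (hC : ∀ v ∈ C.nodes, ∃ x, v = latticePoint x)
    {D : ℕ} (hD : ∀ m ∈ C.sessions, ∃ i, (D : ℝ) ≤ |m.2 i - m.1 i|)
    {n : ℕ} {L : List (Transmission d)} (h : C.IsSolution (routing d) n L) :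
    C.sessions.card * n * D ≤ ⌊C.range⌋₊ * L.length := by
  classical
  have h1 : ∀ p ∈ C.sessions ×ˢ Finset.range n,
      D ≤ ⌊C.range⌋₊ * (L.map Prod.snd).count (sourceSymbol p.1 p.2) := by
    rintro ⟨m, j⟩ hp
    obtain ⟨hm, hj⟩ := Finset.mem_product.1 hp
    obtain ⟨i, hi⟩ := hD m hm
    have := hi.trans (C.abs_coord_sub_le hC h.1 m j i (C.receiver_mem m hm)
      (h.2 m hm j (Finset.mem_range.1 hj)))
    exact_mod_cast this
  calc C.sessions.card * n * D = ∑ _p ∈ C.sessions ×ˢ Finset.range n, D := by simp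
    _ ≤ ∑ p ∈ C.sessions ×ˢ Finset.range n,
        ⌊C.range⌋₊ * (L.map Prod.snd).count (sourceSymbol p.1 p.2) := Finset.sum_le_sum h1
    _ = ⌊C.range⌋₊ * ∑ σ ∈ (C.sessions ×ˢ Finset.range n).image (fun p => sourceSymbol p.1 p.2),
        (L.map Prod.snd).count σ := by
      rw [Finset.sum_image, Finset.mul_sum]
      intro p _ q _ hpq
      exact Prod.ext (sourceSymbol_injective hpq).1 (sourceSymbol_injective hpq).2
    _ ≤ ⌊C.range⌋₊ * L.length := by
      refine Nat.mul_le_mul_left _ ((sum_count_le_length _ _).trans ?_)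
      simp

end Routing

/-! ### The grid configuration -/

section Grid

variable {d : ℕ}

/-- The coordinate at which sessions in an axis direction start: `0` for the increasing direction
(`true`), `K + 1` for the decreasing one (`false`). -/
def startCoord (K : ℕ) (b : Bool) : ℤ := if b then 0 else K + 1

/-- The number of unit steps from the start of a session in direction `b` to coordinate `c`. -/
def stepsFromStart (K : ℕ) (b : Bool) (c : ℤ) : ℤ := if b then c else K + 1 - c

/-- The session along the axis `i`, in the direction given by `b`, on the line through `x`. -/
noncomputable def lineSession (K : ℕ) (i : Fin d) (b : Bool) (x : Fin d → ℤ) : Session d :=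
  (latticePoint (Function.update x i (startCoord K b)),
    latticePoint (Function.update x i (startCoord K !b)))

/-- The lines parallel to the axis `i` that carry sessions, each given by its point with `i`-th
coordinate `0`. The other coordinates lie strictly between those of opposite faces. -/
noncomputable def lines (d K : ℕ) (i : Fin d) : Finset (Fin d → ℤ) :=
  Fintype.piFinset fun j => if j = i then {0} else Finset.Icc 1 (K : ℤ)

lemma mem_lines {K : ℕ} {i : Fin d} {x : Fin d → ℤ} :
    x ∈ lines d K i ↔ x i = 0 ∧ ∀ j, j ≠ i → 1 ≤ x j ∧ x j ≤ K := by
  rw [lines, Fintype.mem_piFinset]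
  constructor
  · intro h
    refine ⟨by simpa using h i, fun j hj => by simpa [hj] using h j⟩
  · rintro ⟨h0, h⟩ j
    by_cases hj : j = i
    · subst hj; simpa using h0
    · simpa [hj] using h j hj

lemma card_lines (K : ℕ) (i : Fin d) : (lines d K i).card = K ^ (d - 1) := by
  rw [lines, Fintype.card_piFinset, ← Finset.mul_prod_erase _ _ (Finset.mem_univ i),
    Finset.prod_congr rfl (g := fun _ => K)]
  · simp
  · intro j hj
    simp [Finset.ne_of_mem_erase hj]

/-- Indices for all sessions: an axis, a direction along it, and a line. -/
noncomputable def directedLines (d K : ℕ) : Finset (Σ _ : Fin d × Bool, Fin d → ℤ) :=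
  Finset.univ.sigma fun p => lines d K p.1

lemma mem_directedLines {K : ℕ} {e : Σ _ : Fin d × Bool, Fin d → ℤ} :
    e ∈ directedLines d K ↔ e.2 ∈ lines d K e.1.1 := by
  simp [directedLines]

lemma card_directedLines (d K : ℕ) : (directedLines d K).card = 2 * d * K ^ (d - 1) := by
  rw [directedLines, Finset.card_sigma]
  simp [card_lines, mul_comm]

/-- The lattice points `{0, …, K + 1}ᵈ`. -/
noncomputable def box (d K : ℕ) : Finset (Fin d → ℤ) :=
  Fintype.piFinset fun _ => Finset.Icc 0 ((K : ℤ) + 1)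

lemma mem_box {K : ℕ} {x : Fin d → ℤ} : x ∈ box d K ↔ ∀ j, 0 ≤ x j ∧ x j ≤ K + 1 := by
  simp [box]

/-- The interior points `{1, …, K}ᵈ` of the box. -/
noncomputable def interiorBox (d K : ℕ) : Finset (Fin d → ℤ) :=
  Fintype.piFinset fun _ => Finset.Icc 1 (K : ℤ)

lemma mem_interiorBox {K : ℕ} {x : Fin d → ℤ} :
    x ∈ interiorBox d K ↔ ∀ j, 1 ≤ x j ∧ x j ≤ K := by
  simp [interiorBox]

lemma card_interiorBox (d K : ℕ) : (interiorBox d K).card = K ^ d := by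
  simp [interiorBox]

lemma update_startCoord_mem_box {K : ℕ} {i : Fin d} {x : Fin d → ℤ} (hx : x ∈ lines d K i)
    (b : Bool) : Function.update x i (startCoord K b) ∈ box d K := by
  rw [mem_box]
  intro j
  rcases eq_or_ne j i with rfl | hj
  · cases b <;> simp [startCoord] <;> positivity
  · have := (mem_lines.1 hx).2 j hj
    rw [Function.update_of_ne hj]
    omega

open Classical in
/-- The nodes `{0, …, K + 1}ᵈ` with range `√d`, which reaches across the diagonal of a unit cube,
and sessions in both directions between opposite faces. -/
noncomputable def grid (d K : ℕ) (hd : 0 < d) : Config d where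
  nodes := (box d K).image latticePoint
  range := √d
  range_pos := Real.sqrt_pos.2 (by exact_mod_cast hd)
  sessions := (directedLines d K).image fun e => lineSession K e.1.1 e.1.2 e.2
  source_mem := by
    simp only [Finset.mem_image]
    rintro _ ⟨e, he, rfl⟩
    exact ⟨_, update_startCoord_mem_box (mem_directedLines.1 he) _, rfl⟩
  receiver_mem := by
    simp only [Finset.mem_image]
    rintro _ ⟨e, he, rfl⟩
    exact ⟨_, update_startCoord_mem_box (mem_directedLines.1 he) _, rfl⟩

lemma mem_grid_nodes {K : ℕ} {hd : 0 < d} {v : Point d} :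
    v ∈ (grid d K hd).nodes ↔ ∃ x ∈ box d K, latticePoint x = v := by
  simp [grid]

lemma mem_grid_sessions {K : ℕ} {hd : 0 < d} {m : Session d} :
    m ∈ (grid d K hd).sessions ↔
      ∃ i b, ∃ x ∈ lines d K i, lineSession K i b x = m := by
  simp only [grid, Finset.mem_image]
  constructor
  · rintro ⟨e, he, rfl⟩
    exact ⟨_, _, _, mem_directedLines.1 he, rfl⟩
  · rintro ⟨i, b, x, hx, rfl⟩
    exact ⟨⟨(i, b), x⟩, mem_directedLines.2 hx, rfl⟩

lemma lineSession_injOn (K : ℕ) :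
    Set.InjOn (fun e : Σ _ : Fin d × Bool, Fin d → ℤ => lineSession K e.1.1 e.1.2 e.2)
      (directedLines d K : Set _) := by
  rintro ⟨⟨i, b⟩, x⟩ hx ⟨⟨i', b'⟩, x'⟩ hx' h
  obtain ⟨hx0, -⟩ := mem_lines.1 (mem_directedLines.1 hx)
  obtain ⟨hx0', -⟩ := mem_lines.1 (mem_directedLines.1 hx')
  dsimp only at hx0 hx0'
  have h1 := latticePoint_injective (congrArg Prod.fst h)
  have h2 := latticePoint_injective (congrArg Prod.snd h)
  dsimp only at h1 h2
  have hi : i = i' := by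
    by_contra hne
    have e1 := congrFun h1 i
    have e2 := congrFun h2 i
    rw [Function.update_self, Function.update_of_ne hne] at e1 e2
    rw [← e1] at e2
    cases b <;> simp [startCoord] at e2 <;> omega
  subst hi
  have hb : b = b' := by
    have e1 := congrFun h1 i
    rw [Function.update_self, Function.update_self] at e1
    cases b <;> cases b' <;> simp [startCoord] at e1 ⊢ <;> omega
  subst hb
  have hx : x = x' := by
    funext j
    rcases eq_or_ne j i with rfl | hj
    · rw [hx0, hx0']
    · simpa [hj] using congrFun h1 j
  rw [hx]

lemma card_grid_sessions (K : ℕ) (hd : 0 < d) :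
    (grid d K hd).sessions.card = 2 * d * K ^ (d - 1) := by
  classical
  rw [← card_directedLines, ← Finset.card_image_of_injOn (lineSession_injOn K)]
  simp only [grid]

lemma le_minTransmissions_routing_grid (K : ℕ) (hd : 0 < d) :
    ((2 * d * K ^ (d - 1) * (K + 1) : ℕ) : ℝ≥0∞) / (⌊√(d : ℝ)⌋₊ : ℕ) ≤
      (grid d K hd).minTransmissions (routing d) := by
  refine le_iInf₂ fun n hn => le_iInf₂ fun L hL => ?_
  have hC : ∀ v ∈ (grid d K hd).nodes, ∃ x, v = latticePoint x := fun v hv => by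
    obtain ⟨x, -, rfl⟩ := mem_grid_nodes.1 hv
    exact ⟨x, rfl⟩
  have hD : ∀ m ∈ (grid d K hd).sessions, ∃ i, ((K + 1 : ℕ) : ℝ) ≤ |m.2 i - m.1 i| := by
    intro m hm
    obtain ⟨i, b, x, -, rfl⟩ := mem_grid_sessions.1 hm
    refine ⟨i, ?_⟩
    have : |(startCoord K (!b) : ℝ) - startCoord K b| = K + 1 := by
      cases b <;> simp [startCoord] <;> first
        | positivity
        | (rw [← abs_neg, abs_of_nonneg] <;> [ring; (ring_nf; positivity)])
    simp [lineSession, this]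
  have h := (grid d K hd).le_floor_mul_length hC hD hL
  rw [card_grid_sessions, show (grid d K hd).range = √d from rfl] at h
  refine ENNReal.div_le_of_le_mul ?_
  rw [mul_comm (_ / _), ← mul_div_assoc, ENNReal.le_div_iff_mul_le
    (Or.inl (by exact_mod_cast (by omega : n ≠ 0))) (Or.inl (ENNReal.natCast_ne_top n))]
  refine le_trans (le_of_eq ?_) ((Nat.cast_le (α := ℝ≥0∞)).2 h |>.trans_eq ?_)
  · push_cast; ring
  · push_cast; ring

end Grid

/-! ### Superposed waves -/

section Waves

variable {d : ℕ}

open Classical in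
/-- The source symbol with index `t` of the session on the line through `x`, extended by `0` to
lines without session and to times outside `{0, …, n - 1}`. -/
noncomputable def lineSymbol (K n : ℕ) (i : Fin d) (b : Bool) (x : Fin d → ℤ) (t : ℤ) : Symb d :=
  if (∀ j, j ≠ i → 1 ≤ x j ∧ x j ≤ K) ∧ 0 ≤ t ∧ t < n then
    sourceSymbol (lineSession K i b x) t.toNat
  else 0

lemma lineSymbol_of_neg {K n : ℕ} {i : Fin d} {b : Bool} {x : Fin d → ℤ} {t : ℤ} (ht : t < 0) :
    lineSymbol K n i b x t = 0 := if_neg (by omega)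

lemma lineSymbol_eq_zero {K n : ℕ} {i j : Fin d} {b : Bool} {x : Fin d → ℤ} {t : ℤ} (hj : j ≠ i)
    (hx : x j < 1 ∨ K < x j) : lineSymbol K n i b x t = 0 :=
  if_neg fun h => by have := h.1 j hj; omega

lemma lineSymbol_congr {K n : ℕ} {i : Fin d} {b : Bool} {x y : Fin d → ℤ} {t : ℤ}
    (h : ∀ j, j ≠ i → x j = y j) : lineSymbol K n i b x t = lineSymbol K n i b y t := by
  have hs : ∀ c, Function.update x i c = Function.update y i c := by
    intro c
    funext j
    rcases eq_or_ne j i with rfl | hj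
    · simp
    · simp [hj, h j hj]
  have hc : (∀ j, j ≠ i → 1 ≤ x j ∧ x j ≤ K) ↔ ∀ j, j ≠ i → 1 ≤ y j ∧ y j ≤ K :=
    forall₂_congr fun j hj => by rw [h j hj]
  simp only [lineSymbol, lineSession, hs, hc]

/-- The symbols of the sessions in one axis direction, travelling at unit speed. -/
noncomputable def wave (K n : ℕ) (i : Fin d) (b : Bool) (x : Fin d → ℤ) (t : ℤ) : Symb d :=
  lineSymbol K n i b x (t - stepsFromStart K b (x i))

lemma waveOp_wave (K n : ℕ) (i : Fin d) (b : Bool) : waveOp i (wave (d := d) K n i b) = 0 := by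
  funext x t
  have h1 : ∀ s, lineSymbol K n i b (x + Pi.single i 1) s = lineSymbol K n i b x s := fun s =>
    lineSymbol_congr fun j hj => by simp [hj]
  have h2 : ∀ s, lineSymbol K n i b (x - Pi.single i 1) s = lineSymbol K n i b x s := fun s =>
    lineSymbol_congr fun j hj => by simp [hj]
  rw [waveOp_apply]
  simp only [wave, h1, h2, Pi.zero_apply]
  cases b
  · have e1 : t - stepsFromStart K false ((x + Pi.single i 1 : Fin d → ℤ) i) =
        t + 1 - stepsFromStart K false (x i) := by simp [stepsFromStart]; ring
    have e2 : t - stepsFromStart K false ((x - Pi.single i 1 : Fin d → ℤ) i) =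
        t - 1 - stepsFromStart K false (x i) := by simp [stepsFromStart]; ring
    rw [e1, e2]; abel
  · have e1 : t - stepsFromStart K true ((x + Pi.single i 1 : Fin d → ℤ) i) =
        t - 1 - stepsFromStart K true (x i) := by simp [stepsFromStart]; ring
    have e2 : t - stepsFromStart K true ((x - Pi.single i 1 : Fin d → ℤ) i) =
        t + 1 - stepsFromStart K true (x i) := by simp [stepsFromStart]; ring
    rw [e1, e2]; abel

/-- The superposition of all waves, in all axis directions. -/
noncomputable def field (K n : ℕ) : (Fin d → ℤ) → ℤ → Symb d :=
  ∑ i, ∑ b, wave K n i b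

lemma field_mem_pastSpan (K n : ℕ) (x : Fin d → ℤ) (t : ℤ) :
    field K n x t ∈ pastSpan (ZMod 2) (field K n) (fun _ => 1) x t := by
  have h : ((List.finRange d).map waveOp).prod (field (d := d) K n) = 0 := by
    rw [field, map_sum]
    refine Finset.sum_eq_zero fun i _ => ?_
    rw [map_sum]
    exact Finset.sum_eq_zero fun b _ => waveProd_eq_zero (List.mem_finRange i) (waveOp_wave K n i b)
  refine pastSpan_mono (fun j => ?_) le_rfl (mem_pastSpan_of_waveProd_eq_zero h x t)
  simp [List.count_eq_one_of_mem (List.nodup_finRange d) (List.mem_finRange j)]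

/-- The superposition of all waves except those along the axis `i`. -/
noncomputable def transverseField (K n : ℕ) (i : Fin d) : (Fin d → ℤ) → ℤ → Symb d :=
  ∑ j ∈ Finset.univ.erase i, ∑ b, wave K n j b

lemma field_eq_transverseField_add (K n : ℕ) (i : Fin d) (b : Bool) (x : Fin d → ℤ) (t : ℤ) :
    field K n x t = transverseField K n i x t + (wave K n i b x t + wave K n i (!b) x t) := by
  have : field (d := d) K n = transverseField K n i + (wave K n i b + wave K n i (!b)) := by
    rw [field, transverseField, ← Finset.sum_erase_add _ _ (Finset.mem_univ i)]
    cases b <;> simp [add_comm]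
  rw [this]
  rfl

lemma transverseField_mem_pastSpan (K n : ℕ) (i : Fin d) (x : Fin d → ℤ) (t : ℤ) :
    transverseField K n i x t ∈
      pastSpan (ZMod 2) (transverseField K n i) (fun j => if j = i then 0 else 1) x t := by
  set l := (List.finRange d).erase i with hl
  have hnd : l.Nodup := (List.nodup_finRange d).erase i
  have h : (l.map waveOp).prod (transverseField (d := d) K n i) = 0 := by
    rw [transverseField, map_sum]
    refine Finset.sum_eq_zero fun j hj => ?_
    rw [map_sum]
    refine Finset.sum_eq_zero fun b _ => waveProd_eq_zero ?_ (waveOp_wave K n j b)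
    exact (List.mem_erase_of_ne (Finset.ne_of_mem_erase hj)).2 (List.mem_finRange j)
  refine pastSpan_mono (fun j => ?_) le_rfl (mem_pastSpan_of_waveProd_eq_zero h x t)
  by_cases hj : j = i
  · subst hj
    have : j ∉ l := (List.nodup_finRange d).not_mem_erase
    simp [List.count_eq_zero_of_not_mem this]
  · have := List.nodup_iff_count_le_one.1 hnd j
    simp [hj]
    omega

end Waves

/-! ### The network coding solution -/

section Coding

variable {d : ℕ}

/-- The transmissions made in time step `τ`: each interior node broadcasts the superposition of
the waves at its position. The end node of a line in direction `b` broadcasts separately the symbol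
that starts there and the symbol of the opposite session that arrives there. -/
noncomputable def batch (d K n τ : ℕ) : List (Transmission d) :=
  ((interiorBox d K).toList.map fun x => (latticePoint x, field K n x τ)) ++
  (((directedLines d K).toList.map fun e =>
      ((lineSession K e.1.1 e.1.2 e.2).1, lineSymbol K n e.1.1 e.1.2 e.2 τ)) ++
    (directedLines d K).toList.map fun e =>
      ((lineSession K e.1.1 e.1.2 e.2).1, lineSymbol K n e.1.1 (!e.1.2) e.2 (τ - (K + 1))))

lemma length_batch (d K n τ : ℕ) :
    (batch d K n τ).length = K ^ d + 4 * d * K ^ (d - 1) := by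
  simp only [batch, List.length_append, List.length_map, Finset.length_toList, card_interiorBox,
    card_directedLines]
  ring

lemma mem_batch {K n τ : ℕ} {p : Transmission d} : p ∈ batch d K n τ ↔
    (∃ x ∈ interiorBox d K, (latticePoint x, field K n x τ) = p) ∨
    (∃ i b, ∃ x ∈ lines d K i, ((lineSession K i b x).1, lineSymbol K n i b x τ) = p) ∨
    ∃ i b, ∃ x ∈ lines d K i,
      ((lineSession K i b x).1, lineSymbol K n i (!b) x (τ - (K + 1))) = p := by
  simp only [batch, List.mem_append, List.mem_map, Finset.mem_toList, mem_directedLines]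
  refine or_congr Iff.rfl (or_congr ?_ ?_) <;>
  · constructor
    · rintro ⟨e, he, rfl⟩
      exact ⟨_, _, _, he, rfl⟩
    · rintro ⟨i, b, x, hx, rfl⟩
      exact ⟨⟨(i, b), x⟩, hx, rfl⟩

/-- The symbols that node `u` can compute from what it has before time step `τ`. -/
noncomputable def knowledge (K n : ℕ) (hd : 0 < d) (τ : ℕ) (u : Point d) :
    Submodule (ZMod 2) (Symb d) :=
  Submodule.span (ZMod 2) ((grid d K hd).available n (steps (batch d K n) τ) u)

variable {K n : ℕ} {hd : 0 < d}

lemma mem_knowledge_of_mem_batch {s τ : ℕ} (hs : s < τ) {u v : Point d} {σ : Symb d}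
    (h : (v, σ) ∈ batch d K n s) (huv : ‖u - v‖ ≤ √d) : σ ∈ knowledge K n hd τ u :=
  Submodule.subset_span (Or.inr ⟨v, mem_steps hs h, huv⟩)

lemma exists_lines_congr {i : Fin d} {x : Fin d → ℤ} (hx : ∀ j, j ≠ i → 1 ≤ x j ∧ x j ≤ K) :
    ∃ z ∈ lines d K i, ∀ j, j ≠ i → x j = z j :=
  ⟨Function.update x i 0, mem_lines.2 ⟨by simp, fun j hj => by simpa [hj] using hx j hj⟩,
    fun j hj => by simp [hj]⟩

/-- Nodes near the end of a line learn both symbols that its end node broadcasts, also when they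
are `0` because the line has no session or the time is outside the range of the session. -/
lemma lineSymbol_mem_knowledge {i : Fin d} (b : Bool) {x : Fin d → ℤ} {s : ℤ} {τ : ℕ}
    (hs : s < τ) {u : Point d}
    (hu : ‖u - latticePoint (Function.update x i (startCoord K b))‖ ≤ √d) :
    lineSymbol K n i b x s ∈ knowledge K n hd τ u ∧
      lineSymbol K n i (!b) x (s - (K + 1)) ∈ knowledge K n hd τ u := by
  rcases lt_or_ge s 0 with h0 | h0
  · rw [lineSymbol_of_neg h0, lineSymbol_of_neg (by omega)]
    exact ⟨zero_mem _, zero_mem _⟩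
  by_cases hx : ∀ j, j ≠ i → 1 ≤ x j ∧ x j ≤ K
  · obtain ⟨z, hz, hxz⟩ := exists_lines_congr hx
    lift s to ℕ using h0
    have he : Function.update x i (startCoord K b) = Function.update z i (startCoord K b) := by
      funext j
      rcases eq_or_ne j i with rfl | hj
      · simp
      · simp [hj, hxz j hj]
    rw [he] at hu
    rw [lineSymbol_congr hxz, lineSymbol_congr hxz]
    have hs' : s < τ := by exact_mod_cast hs
    exact ⟨mem_knowledge_of_mem_batch hs' (mem_batch.2 (Or.inr (Or.inl ⟨i, b, z, hz, rfl⟩))) hu,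
      mem_knowledge_of_mem_batch hs' (mem_batch.2 (Or.inr (Or.inr ⟨i, b, z, hz, rfl⟩))) hu⟩
  · push Not at hx
    obtain ⟨j, hj, hx⟩ := hx
    have hx' : x j < 1 ∨ K < x j := by
      by_contra! h
      exact absurd (hx h.1) (by omega)
    rw [lineSymbol_eq_zero hj hx', lineSymbol_eq_zero hj hx']
    exact ⟨zero_mem _, zero_mem _⟩

/-- Nodes near a point of the box learn the field there. On a face only the waves perpendicular to
the face are present, and the field is the sum of the two symbols broadcast there. -/
lemma field_mem_knowledge {x : Fin d → ℤ} (hx : x ∈ box d K) {s : ℤ} {τ : ℕ} (hs : s < τ)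
    {u : Point d} (hu : ‖u - latticePoint x‖ ≤ √d) :
    field K n x s ∈ knowledge K n hd τ u := by
  rw [mem_box] at hx
  by_cases hint : ∀ j, 1 ≤ x j ∧ x j ≤ K
  · rcases lt_or_ge s 0 with h0 | h0
    · have : field K n x s = 0 := by
        simp only [field, Finset.sum_apply]
        refine Finset.sum_eq_zero fun i _ => Finset.sum_eq_zero fun b _ => lineSymbol_of_neg ?_
        have := hx i
        cases b <;> simp [stepsFromStart] <;> omega
      rw [this]
      exact zero_mem _
    · lift s to ℕ using h0
      exact mem_knowledge_of_mem_batch (by exact_mod_cast hs)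
        (mem_batch.2 (Or.inl ⟨x, mem_interiorBox.2 hint, rfl⟩)) hu
  · obtain ⟨i, hi⟩ := not_forall.1 hint
    obtain ⟨b, hb⟩ : ∃ b, x i = startCoord K b := by
      have := hx i
      rcases (by omega : x i = 0 ∨ x i = K + 1) with h | h
      · exact ⟨true, h⟩
      · exact ⟨false, h⟩
    have htr : transverseField K n i x s = 0 := by
      simp only [transverseField, Finset.sum_apply]
      refine Finset.sum_eq_zero fun j hj => Finset.sum_eq_zero fun c _ => ?_
      exact lineSymbol_eq_zero (Finset.ne_of_mem_erase hj).symm (by omega)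
    have e1 : wave K n i b x s = lineSymbol K n i b x s := by
      rw [wave, hb]
      congr 1
      cases b <;> simp [stepsFromStart, startCoord]
    have e2 : wave K n i (!b) x s = lineSymbol K n i (!b) x (s - (K + 1)) := by
      rw [wave, hb]
      congr 1
      cases b <;> simp [stepsFromStart, startCoord]
    rw [field_eq_transverseField_add K n i b, htr, zero_add, e1, e2]
    have := lineSymbol_mem_knowledge (n := n) (hd := hd) b (x := x) (i := i) hs (u := u)
      (by rwa [← hb, Function.update_eq_self])
    exact add_mem this.1 this.2

lemma field_mem_knowledge_of_interior {x : Fin d → ℤ} (hx : x ∈ interiorBox d K) (τ : ℕ) :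
    field K n x τ ∈ knowledge K n hd τ (latticePoint x) := by
  rw [mem_interiorBox] at hx
  have h := field_mem_pastSpan K n x τ
  refine (Submodule.span_le.2 ?_ : _ ≤ knowledge K n hd τ (latticePoint x)) h
  rintro _ ⟨y, s, hy, hs, rfl⟩
  refine field_mem_knowledge (mem_box.2 fun j => ?_) hs (norm_latticePoint_sub_le fun j => ?_)
  · have h1 : |y j - x j| ≤ 1 := hy j
    rw [abs_le] at h1
    have := hx j
    omega
  · rw [abs_sub_comm]
    exact hy j

/-- The end node of a line can decode the symbol that arrives there: on the adjacent layer, the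
waves along the line are separated from the transverse ones by the wave operators of all other
axes. -/
lemma arriving_mem_knowledge (hK : 1 ≤ K) {i : Fin d} {b : Bool} {x : Fin d → ℤ}
    (hx : x ∈ lines d K i) (τ : ℕ) :
    lineSymbol K n i (!b) x (τ - (K + 1)) ∈ knowledge K n hd τ (lineSession K i b x).1 := by
  obtain ⟨-, hx⟩ := mem_lines.1 hx
  -- `c` is the `i`-th coordinate of the layer next to the face.
  obtain ⟨c, hc, hcK, hcb, hcb'⟩ : ∃ c : ℤ, |startCoord K b - c| ≤ 1 ∧ (1 ≤ c ∧ c ≤ K) ∧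
      stepsFromStart K b c = 1 ∧ stepsFromStart K (!b) c = K := by
    cases b
    · exact ⟨K, by simp [startCoord], by omega, by simp [stepsFromStart], by simp [stepsFromStart]⟩
    · exact ⟨1, by simp [startCoord], by omega, by simp [stepsFromStart], by simp [stepsFromStart]⟩
  set u := (lineSession K i b x).1 with hu
  set y := Function.update x i c with hy
  have hyi : y i = c := by simp [hy]
  have hyj : ∀ j, j ≠ i → y j = x j := fun j hj => by simp [hy, hj]
  -- The face broadcasts the two waves along the line, from which the values they take in this layer
  -- at an earlier time follow; the arriving wave reaches the face one step later.
  have hwave : ∀ w : Fin d → ℤ, ∀ s : ℤ, (∀ j, |w j - y j| ≤ if j = i then 0 else 1) →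
      s < τ - 1 →
      wave K n i b w s ∈ knowledge K n hd τ u ∧ wave K n i (!b) w s ∈ knowledge K n hd τ u := by
    intro w s hw hs
    have hwi : w i = c := by
      have := hw i
      rw [if_pos rfl, hyi, abs_nonpos_iff] at this
      omega
    have hnear : ‖u - latticePoint (Function.update w i (startCoord K b))‖ ≤ √d := by
      refine norm_latticePoint_sub_le fun j => ?_
      rcases eq_or_ne j i with rfl | hj
      · simp
      · have := hw j
        rw [if_neg hj, hyj j hj] at this
        simpa [hj, abs_sub_comm] using this
    have e : s - (K : ℤ) = s + 1 - (K + 1) := by ring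
    rw [wave, wave, hwi, hcb, hcb', e]
    exact ⟨(lineSymbol_mem_knowledge b (by omega) hnear).1,
      (lineSymbol_mem_knowledge b (by omega) hnear).2⟩
  have hfield : ∀ w : Fin d → ℤ, ∀ s : ℤ, (∀ j, |w j - y j| ≤ if j = i then 0 else 1) →
      s < τ → field K n w s ∈ knowledge K n hd τ u := by
    intro w s hw hs
    refine field_mem_knowledge (mem_box.2 fun j => ?_) hs (norm_latticePoint_sub_le fun j => ?_)
    · have h1 := hw j
      rcases eq_or_ne j i with rfl | hj
      · rw [if_pos rfl, hyi, abs_nonpos_iff] at h1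
        omega
      · rw [if_neg hj, hyj j hj, abs_le] at h1
        have := hx j hj
        omega
    · have h1 := hw j
      rcases eq_or_ne j i with rfl | hj
      · rw [if_pos rfl, hyi, abs_nonpos_iff, sub_eq_zero] at h1
        simpa [h1] using hc
      · rw [if_neg hj, hyj j hj] at h1
        simpa [hj, abs_sub_comm] using h1
  have hself : ∀ j, |y j - y j| ≤ if j = i then (0 : ℤ) else 1 := fun j => by
    simp
    split_ifs <;> simp
  have htr : transverseField K n i y (τ - 1) ∈ knowledge K n hd τ u := by
    have h := transverseField_mem_pastSpan K n i y (τ - 1)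
    refine (Submodule.span_le.2 ?_ : _ ≤ knowledge K n hd τ u) h
    rintro _ ⟨w, s, hw, hs, rfl⟩
    rw [← add_sub_cancel_right (transverseField K n i w s)
      (wave K n i b w s + wave K n i (!b) w s), ← field_eq_transverseField_add]
    exact sub_mem (hfield w s hw (by omega))
      (add_mem (hwave w s hw hs).1 (hwave w s hw hs).2)
  have hown : wave K n i b y (τ - 1) ∈ knowledge K n hd τ u := by
    rw [wave, hyi, hcb, lineSymbol_congr hyj]
    exact (lineSymbol_mem_knowledge b (by omega) (by simp [hu, lineSession])).1
  have e : lineSymbol K n i (!b) x (τ - (K + 1)) = field K n y (τ - 1) -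
      transverseField K n i y (τ - 1) - wave K n i b y (τ - 1) := by
    rw [field_eq_transverseField_add K n i b, wave, wave, hyi, hcb', lineSymbol_congr hyj,
      lineSymbol_congr hyj]
    rw [show (τ : ℤ) - (K + 1) = τ - 1 - K by ring]
    abel
  rw [e]
  exact sub_mem (sub_mem (hfield y _ hself (by omega)) htr) hown

lemma sourceSymbol_eq_lineSymbol {i : Fin d} {b : Bool} {x : Fin d → ℤ} (hx : x ∈ lines d K i)
    {j : ℕ} (hj : j < n) : sourceSymbol (lineSession K i b x) j = lineSymbol K n i b x j := by
  rw [lineSymbol, if_pos ⟨(mem_lines.1 hx).2, by omega, by omega⟩, Int.toNat_natCast]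

lemma departing_mem_knowledge {i : Fin d} {b : Bool} {x : Fin d → ℤ} (hx : x ∈ lines d K i)
    (τ : ℕ) : lineSymbol K n i b x τ ∈ knowledge K n hd τ (lineSession K i b x).1 := by
  by_cases h : τ < n
  · rw [← sourceSymbol_eq_lineSymbol hx h]
    exact Submodule.subset_span (Or.inl
      ⟨_, mem_grid_sessions.2 ⟨i, b, x, hx, rfl⟩, rfl, τ, h, rfl⟩)
  · rw [lineSymbol, if_neg (by omega)]
    exact zero_mem _

lemma isSolution_steps_batch (hK : 1 ≤ K) (n : ℕ) (hd : 0 < d) :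
    (grid d K hd).IsSolution (networkCoding d) n (steps (batch d K n) (n + K + 1)) := by
  refine ⟨(grid d K hd).isSchedule_steps (fun τ p hp => ?_) _, fun m hm j hj => ?_⟩
  · have hnode : ∀ i b, ∀ x ∈ lines d K i, (lineSession K i b x).1 ∈ (grid d K hd).nodes :=
      fun i b x hx => mem_grid_nodes.2 ⟨_, update_startCoord_mem_box hx b, rfl⟩
    rcases mem_batch.1 hp with ⟨x, hx, rfl⟩ | ⟨i, b, x, hx, rfl⟩ | ⟨i, b, x, hx, rfl⟩
    · refine ⟨mem_grid_nodes.2 ⟨x, mem_box.2 fun j => ?_, rfl⟩,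
        field_mem_knowledge_of_interior hx τ⟩
      have := mem_interiorBox.1 hx j
      omega
    · exact ⟨hnode i b x hx, departing_mem_knowledge hx τ⟩
    · exact ⟨hnode i b x hx, arriving_mem_knowledge hK hx τ⟩
  · obtain ⟨i, b, x, hx, rfl⟩ := mem_grid_sessions.1 hm
    -- The receiver hears its own broadcast of the symbol.
    have := (lineSymbol_mem_knowledge (K := K) (n := n) (hd := hd) (i := i) (x := x) (s := j + (K + 1))
      (τ := n + K + 1) (!b) (by push_cast; omega)
      (u := (lineSession K i b x).2) (by simp [lineSession])).2
    rw [Bool.not_not, add_sub_cancel_right, ← sourceSymbol_eq_lineSymbol hx hj] at this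
    exact this

lemma minTransmissions_networkCoding_grid_le (hK : 1 ≤ K) (hn : 1 ≤ n) (hd : 0 < d) :
    (grid d K hd).minTransmissions (networkCoding d) ≤
      (((n + K + 1) * (K ^ d + 4 * d * K ^ (d - 1)) : ℕ) : ℝ≥0∞) / n := by
  have := (grid d K hd).minTransmissions_le hn (isSolution_steps_batch hK n hd)
  rwa [length_steps (length_batch d K n)] at this

end Coding

/-! ### The limit of large grids -/

lemma floor_sqrt_pos {d : ℕ} (hd : 0 < d) : 0 < ⌊√(d : ℝ)⌋₊ :=
  Nat.floor_pos.2 (Real.one_le_sqrt.2 (by exact_mod_cast hd))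

/-- The ratio for a grid with `K` interior layers, from coding over `(K + 1)²` symbols. -/
lemma ofReal_le_energyBenefit {d K : ℕ} (hd : 0 < d) (hK : 1 ≤ K) :
    ENNReal.ofReal (2 * d / ⌊√(d : ℝ)⌋₊ * (((K : ℝ) + 1) / (K + 2) * ((K + 1) / (K + 4 * d)))) ≤
      energyBenefit d := by
  refine le_trans ?_ (le_iSup _ (grid d K hd))
  refine le_trans ?_ (ENNReal.div_le_div (le_minTransmissions_routing_grid K hd)
    (minTransmissions_networkCoding_grid_le (n := (K + 1) ^ 2) hK (Nat.one_le_pow _ _ (by omega))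
      hd))
  have hq : (0 : ℝ) < ⌊√(d : ℝ)⌋₊ := by exact_mod_cast floor_sqrt_pos hd
  have hK' : (0 : ℝ) < K := by exact_mod_cast hK
  have hd' : (0 : ℝ) < d := by exact_mod_cast hd
  rw [← ENNReal.ofReal_natCast, ← ENNReal.ofReal_natCast, ← ENNReal.ofReal_natCast,
    ← ENNReal.ofReal_natCast, ← ENNReal.ofReal_div_of_pos hq,
    ← ENNReal.ofReal_div_of_pos (by push_cast; positivity),
    ← ENNReal.ofReal_div_of_pos (by push_cast; positivity)]
  refine ENNReal.ofReal_le_ofReal (le_of_eq ?_)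
  obtain ⟨d, rfl⟩ : ∃ e, d = e + 1 := ⟨d - 1, by omega⟩
  rw [Nat.add_sub_cancel]
  push_cast at hd' ⊢
  rw [show (K : ℝ) ^ (d + 1) + 4 * (d + 1) * K ^ d = K ^ d * (K + 4 * (d + 1)) by ring,
    show ((K : ℝ) + 1) ^ 2 + K + 1 = (K + 1) * (K + 2) by ring]
  field_simp

lemma two_mul_div_floor_sqrt_le_energyBenefit {d : ℕ} (hd : 1 ≤ d) :
    2 * (d : ℝ≥0∞) / (⌊√(d : ℝ)⌋₊ : ℕ) ≤ energyBenefit d := by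
  have hq : (0 : ℝ) < ⌊√(d : ℝ)⌋₊ := by exact_mod_cast floor_sqrt_pos hd
  have hlim : ∀ c : ℝ, Filter.Tendsto (fun K : ℕ => ((K : ℝ) + 1) / (K + c)) Filter.atTop
      (nhds 1) := by
    intro c
    simpa [add_comm] using tendsto_add_mul_div_add_mul_atTop_nhds (1 : ℝ) c 1 one_ne_zero
  have h := ENNReal.tendsto_ofReal
    (((hlim 2).mul (hlim (4 * d))).const_mul (2 * (d : ℝ) / ⌊√(d : ℝ)⌋₊))
  have e : ENNReal.ofReal (2 * (d : ℝ) / ⌊√(d : ℝ)⌋₊ * (1 * 1)) =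
      2 * (d : ℝ≥0∞) / (⌊√(d : ℝ)⌋₊ : ℕ) := by
    rw [mul_one, mul_one, ENNReal.ofReal_div_of_pos hq, ENNReal.ofReal_mul zero_le_two,
      ENNReal.ofReal_natCast, ENNReal.ofReal_natCast, ENNReal.ofReal_ofNat]
  rw [e] at h
  refine le_of_tendsto h ?_
  filter_upwards [Filter.eventually_ge_atTop 1] with K hK
  exact ofReal_le_energyBenefit hd hK

lemma floor_sqrt_eq_one {d : ℕ} (h1 : 1 ≤ d) (h4 : d < 4) : ⌊√(d : ℝ)⌋₊ = 1 := by
  rw [Real.nat_floor_real_sqrt_eq_nat_sqrt]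
  exact le_antisymm (Nat.lt_succ_iff.1 (Nat.sqrt_lt.2 h4)) (Nat.le_sqrt.2 h1)

end WirelessUnicast

theorem theorem1 :
    (∀ d : ℕ, 1 ≤ d →
      2 * (d : ℝ≥0∞) / ((⌊Real.sqrt (d : ℝ)⌋₊ : ℕ) : ℝ≥0∞) ≤ WirelessUnicast.energyBenefit d) ∧
    4 ≤ WirelessUnicast.energyBenefit 2 ∧
    6 ≤ WirelessUnicast.energyBenefit 3 := by
  have h := fun (d : ℕ) (hd : 1 ≤ d) => WirelessUnicast.two_mul_div_floor_sqrt_le_energyBenefit hd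
  have h2 := h 2 (by norm_num)
  have h3 := h 3 (by norm_num)
  rw [WirelessUnicast.floor_sqrt_eq_one (by norm_num) (by norm_num)] at h2 h3
  refine ⟨h, ?_, ?_⟩
  · norm_num at h2
    exact h2
  · norm_num at h3
    exact h3
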